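/- Let $k$ be a field of characteristic different from $2$, and let $$G^2_3=\langle a,b,c \mid a^2=b^2=c^2=1,\ bca=acb\rangle .$$ For maps $\epsilon_1,\epsilon_2:\{a,b,c\}\to\{1,-1\}$ let ${}_{\epsilon_1}W_{\epsilon_2}$ be the one-dimensional bimodule $k$ over the group algebra $kG^2_3$ on which the generators act by $x\cdot 1=\epsilon_1(x)$ and $1\cdot x=\epsilon_2(x)$, $x\in\{a,b,c\}$; write $\epsilon_i$ as the triple of signs of $\epsilon_i(a),\epsilon_i(b),\epsilon_i(c)$. Put $$W_1={}_{+++}W_{+++},\quad W_2={}_{+++}W_{---},\quad W_3={}_{+++}W_{++-},\quad W_4={}_{+++}W_{+--},$$ $$W_5={}_{++-}W_{++-},\quad W_6={}_{++-}W_{--+},\quad W_7={}_{++-}W_{+--},\quad W_8={}_{++-}W_{+-+}.$$ Let $H^2(kG^2_3,W)=\operatorname{Ker}\Delta_2/\operatorname{Im}\Delta_1$ be the second Hochschild cohomology, where, for a $k$-algebra $\Lambda$, a $\Lambda$-bimodule $W$ and $f\in\operatorname{Hom}_k(\Lambda^{\otimes n},W)$, $$\Delta_n f(r_1,\dots,r_{n+1})=r_1f(r_2,\dots,r_{n+1})+\sum_{i=1}^n(-1)^i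 f(r_1,\dots,r_ir_{i+1},\dots,r_{n+1})+(-1)^{n+1}f(r_1,\dots,r_n)r_{n+1}.$$ Then $H^2(kG^2_3,W_i)=0$ for $i=2,3,4,6,7,8$, and $\dim_k H^2(kG^2_3,W_i)=1$ for $i=1,5$. -/

import Mathlib

noncomputable section

/-! ### Hochschild cohomology through the explicit cochain complex -/

namespace Hochschild

/-- Changing one argument of a tuple changes one entry of the contracted tuple, linearly. -/
theorem contractNth_update (k : Type*) {A : Type*} [CommRing k] [Ring A] [Algebra k A] {n : ℕ}
    (j : Fin n) (r : Fin (n + 1) → A) (i : Fin (n + 1)) :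
    ∃ (i' : Fin n) (L : A →ₗ[k] A), ∀ x : A,
      Fin.contractNth j.castSucc (· * ·) (Function.update r i x) =
        Function.update (Fin.contractNth j.castSucc (· * ·) r) i' (L x) := by
  have key : ∀ (i' : Fin n) (L : A →ₗ[k] A),
      (∀ x, Fin.contractNth j.castSucc (· * ·) (Function.update r i x) i' = L x) →
      (∀ x (l : Fin n), l ≠ i' → Fin.contractNth j.castSucc (· * ·) (Function.update r i x) l =
        Fin.contractNth j.castSucc (· * ·) r l) →
      ∃ (i' : Fin n) (L : A →ₗ[k] A), ∀ x : A,
        Fin.contractNth j.castSucc (· * ·) (Function.update r i x) =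
          Function.update (Fin.contractNth j.castSucc (· * ·) r) i' (L x) := by
    intro i' L h1 h2
    refine ⟨i', L, fun x => funext fun l => ?_⟩
    by_cases hl : l = i'
    · subst hl; simp [h1]
    · rw [Function.update_of_ne hl, h2 x l hl]
  have hi := i.2
  have hj := j.2
  rcases lt_trichotomy i.val j.val with h | h | h
  · refine key ⟨i, by omega⟩ LinearMap.id ?_ ?_
    · intro x
      simp [Fin.contractNth, h]
    · intro x l hl
      have hl' : l.val ≠ i.val := fun e => hl (Fin.ext e)
      simp only [Fin.contractNth, Function.update_apply, Fin.ext_iff, Fin.val_castSucc,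
        Fin.val_succ]
      split_ifs <;> first | rfl | omega
  · refine key j (LinearMap.mulRight k (r j.succ)) ?_ ?_
    · intro x
      simp [Fin.contractNth, Function.update_apply, Fin.ext_iff, h]
    · intro x l hl
      have hl' : l.val ≠ j.val := fun e => hl (Fin.ext e)
      simp only [Fin.contractNth, Function.update_apply, Fin.ext_iff, Fin.val_castSucc,
        Fin.val_succ]
      split_ifs <;> first | rfl | omega
  · by_cases h' : i.val = j.val + 1
    · refine key j (LinearMap.mulLeft k (r j.castSucc)) ?_ ?_
      · intro x
        simp [Fin.contractNth, Function.update_apply, Fin.ext_iff, h']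
      · intro x l hl
        have hl' : l.val ≠ j.val := fun e => hl (Fin.ext e)
        simp only [Fin.contractNth, Function.update_apply, Fin.ext_iff, Fin.val_castSucc,
          Fin.val_succ]
        split_ifs <;> first | rfl | omega
    · refine key ⟨i - 1, by omega⟩ LinearMap.id ?_ ?_
      · intro x
        simp only [Fin.contractNth, Function.update_apply, Fin.ext_iff, Fin.val_castSucc,
          Fin.val_succ, LinearMap.id_apply]
        split_ifs <;> first | rfl | omega
      · intro x l hl
        have hl' : l.val ≠ i.val - 1 := fun e => hl (Fin.ext e)
        simp only [Fin.contractNth, Function.update_apply, Fin.ext_iff, Fin.val_castSucc,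
          Fin.val_succ]
        split_ifs <;> first | rfl | omega

section

variable (k A M : Type*) [CommRing k] [Ring A] [Algebra k A] [AddCommGroup M] [Module k M]

/-- Hochschild `n`-cochains: `k`-multilinear maps `Aⁿ → M`, i.e. `Hom_k(A^{⊗ n}, M)`. -/
abbrev Cochain (n : ℕ) : Type _ := MultilinearMap k (fun _ : Fin n => A) M

variable {k A M}

/-- The cochain `(r₁, …, rₙ₊₁) ↦ f (r₁, …, rᵢ rᵢ₊₁, …, rₙ₊₁)`; the index `j : Fin n` is `i - 1`. -/
def innerFace {n : ℕ} (j : Fin n) (f : Cochain k A M n) : Cochain k A M (n + 1) where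
  toFun r := f (Fin.contractNth j.castSucc (· * ·) r)
  map_update_add' := by
    intro hd r i x y
    obtain rfl := Subsingleton.elim hd (instDecidableEqFin (n + 1))
    obtain ⟨i', L, h⟩ := contractNth_update k j r i
    simp [h]
  map_update_smul' := by
    intro hd r i c x
    obtain rfl := Subsingleton.elim hd (instDecidableEqFin (n + 1))
    obtain ⟨i', L, h⟩ := contractNth_update k j r i
    simp [h]

variable [Module A M] [IsScalarTower k A M]

/-- The cochain `(r₁, …, rₙ₊₁) ↦ r₁ f (r₂, …, rₙ₊₁)`. -/
def leftFace {n : ℕ} (f : Cochain k A M n) : Cochain k A M (n + 1) where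
  toFun r := r 0 • f (Fin.tail r)
  map_update_add' := by
    intro hd r i x y
    obtain rfl := Subsingleton.elim hd (instDecidableEqFin (n + 1))
    refine Fin.cases ?_ (fun i => ?_) i
    · simp [Fin.tail_update_zero, add_smul]
    · simp [Fin.tail_update_succ, Function.update_of_ne (Fin.succ_ne_zero i).symm]
  map_update_smul' := by
    intro hd r i c x
    obtain rfl := Subsingleton.elim hd (instDecidableEqFin (n + 1))
    refine Fin.cases ?_ (fun i => ?_) i
    · simp [Fin.tail_update_zero]
    · have : ∀ (a : A) (m : M), a • c • m = c • a • m := fun a m => by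
        rw [← algebraMap_smul A c m, ← algebraMap_smul A c (a • m), smul_smul, smul_smul,
          Algebra.commutes]
      simp [Fin.tail_update_succ, Function.update_of_ne (Fin.succ_ne_zero i).symm, this]

end

section

variable {k A M : Type*} [CommRing k] [Ring A] [Algebra k A] [AddCommGroup M] [Module k M]
  [Module Aᵐᵒᵖ M] [IsScalarTower k Aᵐᵒᵖ M]

/-- The cochain `(r₁, …, rₙ₊₁) ↦ f (r₁, …, rₙ) rₙ₊₁`. -/
def rightFace {n : ℕ} (f : Cochain k A M n) : Cochain k A M (n + 1) where
  toFun r := MulOpposite.op (r (Fin.last n)) • f (Fin.init r)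
  map_update_add' := by
    intro hd r i x y
    obtain rfl := Subsingleton.elim hd (instDecidableEqFin (n + 1))
    refine Fin.lastCases ?_ (fun i => ?_) i
    · simp [Fin.init_update_last, add_smul]
    · simp [Fin.init_update_castSucc, Function.update_of_ne (Fin.castSucc_lt_last i).ne']
  map_update_smul' := by
    intro hd r i c x
    obtain rfl := Subsingleton.elim hd (instDecidableEqFin (n + 1))
    refine Fin.lastCases ?_ (fun i => ?_) i
    · simp [Fin.init_update_last]
    · have : ∀ (a : Aᵐᵒᵖ) (m : M), a • c • m = c • a • m := fun a m => by
        rw [← algebraMap_smul Aᵐᵒᵖ c m, ← algebraMap_smul Aᵐᵒᵖ c (a • m), smul_smul, smul_smul,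
          Algebra.commutes]
      simp [Fin.init_update_castSucc, Function.update_of_ne (Fin.castSucc_lt_last i).ne', this]

end

section

/- `M` is an `A`-bimodule: a left module over `A` and over `Aᵐᵒᵖ`, with commuting actions, both
compatible with the action of `k`; the right action is `m · r = MulOpposite.op r • m`. -/
variable (k A M : Type*) [CommRing k] [Ring A] [Algebra k A] [AddCommGroup M] [Module k M]
  [Module A M] [IsScalarTower k A M] [Module Aᵐᵒᵖ M] [IsScalarTower k Aᵐᵒᵖ M]

/-- The Hochschild differential
`Δₙ f (r₁, …, rₙ₊₁) = r₁ f (r₂, …, rₙ₊₁) + ∑ᵢ (-1)ⁱ f (r₁, …, rᵢ rᵢ₊₁, …, rₙ₊₁)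
  + (-1)ⁿ⁺¹ f (r₁, …, rₙ) rₙ₊₁`. -/
def differential (n : ℕ) : Cochain k A M n →ₗ[k] Cochain k A M (n + 1) where
  toFun f := leftFace f + ∑ j : Fin n, (-1 : ℤ) ^ (j.val + 1) • innerFace j f
    + (-1 : ℤ) ^ (n + 1) • rightFace f
  map_add' f g := by
    have h1 : leftFace (f + g) = leftFace f + leftFace g := by ext r; simp [leftFace]
    have h2 : rightFace (f + g) = rightFace f + rightFace g := by ext r; simp [rightFace]
    have h3 : ∀ j : Fin n, innerFace j (f + g) = innerFace j f + innerFace j g := fun j => by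
      ext r; simp [innerFace]
    simp only [h1, h2, h3, smul_add, Finset.sum_add_distrib]
    abel
  map_smul' c f := by
    have h1 : leftFace (c • f) = c • leftFace f := by
      ext r
      simp only [leftFace, MultilinearMap.coe_mk, smul_apply]
      rw [← algebraMap_smul A c (f _), ← algebraMap_smul A c (r 0 • f _), smul_smul, smul_smul,
        Algebra.commutes]
    have h2 : rightFace (c • f) = c • rightFace f := by
      ext r
      simp only [rightFace, MultilinearMap.coe_mk, smul_apply]
      rw [← algebraMap_smul Aᵐᵒᵖ c (f _),
        ← algebraMap_smul Aᵐᵒᵖ c (MulOpposite.op (r (Fin.last n)) • f _), smul_smul, smul_smul,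
        Algebra.commutes]
    have h3 : ∀ j : Fin n, innerFace j (c • f) = c • innerFace j f := fun j => by
      ext r; simp [innerFace]
    simp only [h1, h2, h3, smul_add, Finset.smul_sum, RingHom.id_apply, smul_comm c]

/-- Hochschild `n`-cocycles, `Ker Δₙ`. -/
def cocycles (n : ℕ) : Submodule k (Cochain k A M n) :=
  LinearMap.ker (differential k A M n)

/-- Hochschild `n`-coboundaries, `Im Δₙ₋₁` (zero for `n = 0`). -/
def coboundaries : (n : ℕ) → Submodule k (Cochain k A M n)
  | 0 => ⊥
  | n + 1 => LinearMap.range (differential k A M n)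

/-- The Hochschild cohomology `Hⁿ(A, M) = Ker Δₙ / Im Δₙ₋₁` of a `k`-algebra `A` with coefficients
in an `A`-bimodule `M`. -/
abbrev Cohomology [SMulCommClass A Aᵐᵒᵖ M] (n : ℕ) : Type _ :=
  cocycles k A M n ⧸ (coboundaries k A M n).submoduleOf (cocycles k A M n)

end

end Hochschild

/-! ### One-dimensional bimodules -/

/-- The one-dimensional bimodule `k` over a `k`-algebra `A` with `x · w = χ₁(x) w` and
`w · x = χ₂(x) w`, for characters `χ₁ χ₂ : A → k`. -/
@[nolint unusedArguments]
def CharBimodule {k A : Type*} [Field k] [Ring A] [Algebra k A] (_χ₁ _χ₂ : A →ₐ[k] k) : Type _ := k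

namespace CharBimodule

variable {k A : Type*} [Field k] [Ring A] [Algebra k A] (χ₁ χ₂ : A →ₐ[k] k)

instance : AddCommGroup (CharBimodule χ₁ χ₂) := inferInstanceAs (AddCommGroup k)

instance : Module k (CharBimodule χ₁ χ₂) := inferInstanceAs (Module k k)

instance : Module A (CharBimodule χ₁ χ₂) :=
  Module.compHom (CharBimodule χ₁ χ₂) χ₁.toRingHom

instance : Module Aᵐᵒᵖ (CharBimodule χ₁ χ₂) :=
  Module.compHom (CharBimodule χ₁ χ₂) (χ₂.toRingHom.fromOpposite fun _ _ => Commute.all _ _)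

variable {χ₁ χ₂}

theorem smul_def (x : A) (w : CharBimodule χ₁ χ₂) : x • w = χ₁ x • w := rfl

theorem op_smul_def (x : A) (w : CharBimodule χ₁ χ₂) : MulOpposite.op x • w = χ₂ x • w := rfl

instance : IsScalarTower k A (CharBimodule χ₁ χ₂) where
  smul_assoc c x w := by simp [smul_def, mul_smul]

instance : IsScalarTower k Aᵐᵒᵖ (CharBimodule χ₁ χ₂) where
  smul_assoc c x w := by
    induction x with
    | h x => exact (congrArg (· • w) (map_smul χ₂ c x)).trans (mul_smul c (χ₂ x) w)

instance : SMulCommClass A Aᵐᵒᵖ (CharBimodule χ₁ χ₂) where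
  smul_comm x y w := by
    induction y with
    | h y => simp only [smul_def, op_smul_def]; exact smul_comm _ _ _

end CharBimodule

/-! ### The group `G₃²` -/

/-- The generators `a`, `b`, `c`. -/
inductive G23Gen
  | a
  | b
  | c

namespace G23Gen

/-- The relators `a²`, `b²`, `c²`, `bca (acb)⁻¹`. -/
def rels : Set (FreeGroup G23Gen) :=
  {FreeGroup.of a ^ 2, FreeGroup.of b ^ 2, FreeGroup.of c ^ 2,
    (FreeGroup.of b * FreeGroup.of c * FreeGroup.of a) *
      (FreeGroup.of a * FreeGroup.of c * FreeGroup.of b)⁻¹}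

end G23Gen

/-- The group `G₃² = ⟨a, b, c ∣ a² = b² = c² = 1, bca = acb⟩`. -/
abbrev G23 : Type := PresentedGroup G23Gen.rels

namespace G23

/-- The sign assignment `{a, b, c} → {1, -1}` written as a triple of signs. -/
def signs (ea eb ec : ℤˣ) : G23Gen → ℤˣ
  | .a => ea
  | .b => eb
  | .c => ec

theorem lift_eq_one (ε : G23Gen → ℤˣ) : ∀ r ∈ G23Gen.rels, FreeGroup.lift ε r = 1 := by
  intro r hr
  rcases hr with rfl | rfl | rfl | rfl
  · simp
  · simp
  · simp
  · simp only [map_mul, map_inv, FreeGroup.lift_apply_of]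
    rw [mul_inv_eq_one, mul_comm, mul_assoc, mul_comm (ε .c)]

/-- The homomorphism `G₃² → {1, -1}` extending `ε : {a, b, c} → {1, -1}`. -/
def signHom (ε : G23Gen → ℤˣ) : G23 →* ℤˣ := PresentedGroup.toGroup (lift_eq_one ε)

/-- The character of the group algebra `k G₃²` with values `ε(x) = ± 1 ∈ k` on `x ∈ {a, b, c}`. -/
def character (k : Type*) [Field k] (ε : G23Gen → ℤˣ) : MonoidAlgebra k G23 →ₐ[k] k :=
  MonoidAlgebra.lift k k G23
    (((Int.castRingHom k : ℤ →* k).comp (Units.coeHom ℤ)).comp (signHom ε))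

theorem character_of (k : Type*) [Field k] (ε : G23Gen → ℤˣ) (x : G23Gen) :
    character k ε (MonoidAlgebra.of k G23 (PresentedGroup.of x)) = ((ε x : ℤ) : k) := by
  simp [character, signHom]

/-- The bimodule `W = k` over `k G₃²` with left action `x · 1 = ε₁(x)` and right action
`1 · x = ε₂(x)` of the generators `x ∈ {a, b, c}`. -/
abbrev W (k : Type*) [Field k] (ε₁ ε₂ : G23Gen → ℤˣ) : Type _ :=
  CharBimodule (character k ε₁) (character k ε₂)

/-- The second Hochschild cohomology of the group algebra `k G₃²` with coefficients in `W`. -/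
abbrev HH2 (k : Type*) [Field k] (ε₁ ε₂ : G23Gen → ℤˣ) : Type _ :=
  Hochschild.Cohomology k (MonoidAlgebra k G23) (W k ε₁ ε₂) 2

end G23

end

/-! ### Twisted 2-cocycles of a group and their extensions -/

/-! Multiplying a Hochschild 2-cochain by `ε₂(gh)` trivializes the right action, so the cohomology
becomes that of the group with coefficients in `k`, acted on through the character `e = ε₁ε₂`. A
class vanishes exactly when the extension of `G23` by `k` that it defines splits.

Since `bca` is the inverse of `acb`, the relations say that `a`, `b`, `c` and `acb` are involutions.
A splitting is therefore a choice of lifts of `a`, `b`, `c` that are involutions and whose product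
`acb` is one too (`exists_splitting`). As 2 is invertible, an involution `g` with `e g = 1` has
exactly one involutive lift; if `e g = -1`, every lift is involutive.

Hence the extension splits if `e acb = -1`, the last condition being automatic, and also if `e acb =
1` and `e b = -1`, the free lift of `b` being used to meet it. If `e = 1`, all lifts are forced and
the last condition becomes the vanishing of one linear functional, `obstruction`. Its kernel on
cocycles is the coboundaries, and an area form on a plane gives a cocycle where it is nonzero, so
the quotient is a line. -/

/-- The 2-cocycle identity for functions on a group `G` with values in `k`, on which `G` acts
through `e : G →* k`. -/
def IsTwoCocycle {k G : Type*} [Field k] [Group G] (e : G →* k) (f : G → G → k) : Prop :=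
  ∀ g h l, e g * f h l - f (g * h) l + f g (h * l) - f g h = 0

namespace IsTwoCocycle

variable {k G : Type*} [Field k] [Group G] {e : G →* k} {f : G → G → k}

theorem one_left (hf : IsTwoCocycle e f) (g : G) : f 1 g = f 1 1 := by
  have := hf 1 1 g
  simp only [map_one, one_mul] at this
  linear_combination this

theorem one_right (hf : IsTwoCocycle e f) (g : G) : f g 1 = e g * f 1 1 := by
  have := hf g 1 1
  simp only [mul_one] at this
  linear_combination -this

/-- On an involution acting by `-1` the values of a 2-cocycle are determined. -/
theorem apply_self (hf : IsTwoCocycle e f) (hk : (2 : k) ≠ 0) {g : G} (hg : g * g = 1)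
    (he : e g = -1) : f g g = -f 1 1 := by
  -- With `g * g = 1`, the two middle terms reduce to multiples of `f 1 1`.
  have h := hf g g g
  rw [hg, hf.one_left g, hf.one_right g, he] at h
  have : 2 * (f g g + f 1 1) = 0 := by linear_combination -h
  have := (mul_eq_zero.mp this).resolve_left hk
  linear_combination this

end IsTwoCocycle

/-- The extension of `G` by `k` defined by a 2-cocycle. -/
@[ext]
structure CocycleExtension {k G : Type*} [Field k] [Group G] {e : G →* k} {f : G → G → k}
    (hf : IsTwoCocycle e f) where
  /-- The component in the kernel. -/
  val : k
  /-- The component in the quotient. -/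
  base : G

namespace CocycleExtension

variable {k G : Type*} [Field k] [Group G] {e : G →* k} {f : G → G → k} {hf : IsTwoCocycle e f}

instance : Mul (CocycleExtension hf) :=
  ⟨fun x y => ⟨x.val + e x.base * y.val + f x.base y.base, x.base * y.base⟩⟩

/-- The cocycle is not assumed normalized, which moves the identity to `-f 1 1`. -/
instance : One (CocycleExtension hf) := ⟨⟨-f 1 1, 1⟩⟩

instance : Inv (CocycleExtension hf) :=
  ⟨fun x => ⟨-f 1 1 - e x.base⁻¹ * x.val - f x.base⁻¹ x.base, x.base⁻¹⟩⟩

theorem val_mul (x y : CocycleExtension hf) :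
    (x * y).val = x.val + e x.base * y.val + f x.base y.base := rfl

theorem base_mul (x y : CocycleExtension hf) : (x * y).base = x.base * y.base := rfl

theorem val_one : (1 : CocycleExtension hf).val = -f 1 1 := rfl

theorem base_one : (1 : CocycleExtension hf).base = 1 := rfl

theorem val_inv (x : CocycleExtension hf) :
    x⁻¹.val = -f 1 1 - e x.base⁻¹ * x.val - f x.base⁻¹ x.base := rfl

theorem base_inv (x : CocycleExtension hf) : x⁻¹.base = x.base⁻¹ := rfl

instance : Group (CocycleExtension hf) :=
  Group.ofLeftAxioms
    (fun x y z => by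
      ext
      · simp only [val_mul, base_mul, map_mul]
        linear_combination -hf x.base y.base z.base
      · simp only [base_mul, mul_assoc])
    (fun x => by
      ext
      · simp only [val_mul, val_one, base_one, map_one, hf.one_left]
        ring
      · simp only [base_mul, base_one, one_mul])
    (fun x => by
      ext
      · simp only [val_mul, val_one, val_inv, base_inv]
        ring
      · simp only [base_mul, base_inv, base_one, inv_mul_cancel])

/-- The projection of the extension onto the quotient. -/
def proj (hf : IsTwoCocycle e f) : CocycleExtension hf →* G where
  toFun := base
  map_one' := rfl
  map_mul' _ _ := rfl

end CocycleExtension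

/-! ### Splitting the extensions of `G₃²` -/

namespace G23

/-- The image of a generator in `G₃²`. -/
abbrev gen (x : G23Gen) : G23 := PresentedGroup.of x

theorem gen_mul_self (x : G23Gen) : gen x * gen x = 1 := by
  have h : FreeGroup.of x ^ 2 ∈ G23Gen.rels := by
    cases x <;> simp [G23Gen.rels]
  have := PresentedGroup.one_of_mem h
  rw [map_pow, sq] at this
  exact this

/-- The product `acb`, which is again an involution. -/
abbrev acb : G23 := gen .a * gen .c * gen .b

/-- As the generators are involutions, the inverse of `acb` is `bca`, which the last relation
identifies with `acb`. -/
theorem acb_mul_self : acb * acb = 1 := by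
  have h : gen .b * gen .c * gen .a * (gen .a * gen .c * gen .b)⁻¹ = 1 :=
    PresentedGroup.one_of_mem (rels := G23Gen.rels) (by simp [G23Gen.rels])
  rw [mul_inv_eq_one] at h
  have inv (x : G23Gen) : (gen x)⁻¹ = gen x := inv_eq_of_mul_eq_one_left (gen_mul_self x)
  have : acb⁻¹ = acb := by
    rw [acb, mul_inv_rev, mul_inv_rev, inv, inv, inv, ← mul_assoc, h]
  nth_rewrite 1 [← this]
  exact inv_mul_cancel _

/-- Lifts of the generators to an extension of `G₃²` that satisfy the relations split it. -/
theorem exists_splitting {k : Type*} [Field k] {e : G23 →* k} {f : G23 → G23 → k}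
    (hf : IsTwoCocycle e f) (m : G23Gen → k)
    (hm : ∀ x, (1 + e (gen x)) * m x + f (gen x) (gen x) + f 1 1 = 0)
    (hd : (1 + e acb) * (m .a + e (gen .a) * m .c + f (gen .a) (gen .c)
      + e (gen .a * gen .c) * m .b + f (gen .a * gen .c) (gen .b)) + f acb acb + f 1 1 = 0) :
    ∃ φ : G23 → k, (∀ x, φ (gen x) = m x) ∧
      ∀ g h, φ (g * h) = φ g + e g * φ h + f g h := by
  let s : G23Gen → CocycleExtension hf := fun x => ⟨m x, gen x⟩
  have hs (x) : s x * s x = 1 := by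
    ext
    · simp only [CocycleExtension.val_mul, CocycleExtension.val_one, s]
      linear_combination hm x
    · exact gen_mul_self x
  have hsd : s .a * s .c * s .b * (s .a * s .c * s .b) = 1 := by
    ext
    · simp only [CocycleExtension.val_mul, CocycleExtension.val_one, CocycleExtension.base_mul, s]
      linear_combination hd
    · exact acb_mul_self
  have hrel : ∀ r ∈ G23Gen.rels, FreeGroup.lift s r = 1 := by
    intro r hr
    rcases hr with rfl | rfl | rfl | rfl
    · simp [sq, hs]
    · simp [sq, hs]
    · simp [sq, hs]
    · simp only [map_mul, map_inv, FreeGroup.lift_apply_of]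
      have inv (x) : (s x)⁻¹ = s x := inv_eq_of_mul_eq_one_left (hs x)
      rw [mul_inv_eq_one, eq_inv_of_mul_eq_one_left hsd]
      simp only [mul_inv_rev, inv, mul_assoc]
  let σ : G23 →* CocycleExtension hf := PresentedGroup.toGroup hrel
  have hσ (g) : (σ g).base = g := by
    have : (CocycleExtension.proj hf).comp σ = MonoidHom.id G23 := by
      ext x
      simp [σ, s, CocycleExtension.proj]
    exact DFunLike.congr_fun this g
  refine ⟨fun g => (σ g).val, fun x => by simp [σ, s], fun g h => ?_⟩
  simp only [map_mul, CocycleExtension.val_mul, hσ]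

section

variable {k : Type*} [Field k] {e : G23 →* k} {f : G23 → G23 → k}

/-- Lifts of involutions that are again involutions. -/
theorem lift_involution (hf : IsTwoCocycle e f) (hk : (2 : k) ≠ 0) {g : G23} (hg : g * g = 1)
    (he : e g = 1 ∨ e g = -1) :
    (1 + e g) * (-(f 1 1 + f g g) / 2) + f g g + f 1 1 = 0 := by
  -- For `e g = 1` the value is the unique solution; for `e g = -1` its coefficient vanishes and any
  -- value would do.
  rcases he with he | he
  · rw [he]
    field_simp
    ring
  · rw [he, hf.apply_self hk hg he]
    ring

/-- Every lift of `acb` is an involution here, so any involutive lifts of the generators will do. -/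
theorem exists_splitting_of_acb_eq_neg_one (hf : IsTwoCocycle e f) (hk : (2 : k) ≠ 0)
    (he : ∀ x, e (gen x) = 1 ∨ e (gen x) = -1) (hd : e acb = -1) :
    ∃ φ : G23 → k, ∀ g h, φ (g * h) = φ g + e g * φ h + f g h := by
  obtain ⟨φ, -, hφ⟩ := exists_splitting hf
    (fun x => -(f 1 1 + f (gen x) (gen x)) / 2)
    (fun x => lift_involution hf hk (gen_mul_self x) (he x))
    (by rw [hf.apply_self hk acb_mul_self hd, hd]; ring)
  exact ⟨φ, hφ⟩

/-- The lift of `b` is unconstrained by `b² = 1`, and it enters the condition on `acb` with the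
invertible coefficient `2 * e (ac) = -2`. -/
theorem exists_splitting_of_b_eq_neg_one (hf : IsTwoCocycle e f) (hk : (2 : k) ≠ 0)
    (he : ∀ x, e (gen x) = 1 ∨ e (gen x) = -1) (hd : e acb = 1) (hb : e (gen .b) = -1) :
    ∃ φ : G23 → k, ∀ g h, φ (g * h) = φ g + e g * φ h + f g h := by
  have hac : e (gen .a * gen .c) = -1 := by
    rw [map_mul e (gen .a * gen .c), hb] at hd
    linear_combination -hd
  let m : G23Gen → k := fun x => -(f 1 1 + f (gen x) (gen x)) / 2
  -- The solution of the condition on `acb` for the lift of `b`.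
  let n : k := m .a + e (gen .a) * m .c + f (gen .a) (gen .c) + f (gen .a * gen .c) (gen .b)
    + (f acb acb + f 1 1) / 2
  have hm (x) := lift_involution hf hk (gen_mul_self x) (he x)
  obtain ⟨φ, -, hφ⟩ := exists_splitting hf
    (fun | .a => m .a | .b => n | .c => m .c)
    (fun
      | .a => hm .a
      | .b => by rw [hb, hf.apply_self hk (gen_mul_self _) hb]; ring
      | .c => hm .c)
    (by
      simp only [hd, hac, n]
      field_simp
      ring)
  exact ⟨φ, hφ⟩

/-- The obstruction to splitting an extension of `G₃²` with trivial action. -/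
def obstruction (f : G23 → G23 → k) : k :=
  f acb acb + 2 * (f (gen .a) (gen .c) + f (gen .a * gen .c) (gen .b))
    - f (gen .a) (gen .a) - f (gen .b) (gen .b) - f (gen .c) (gen .c) - 2 * f 1 1

/-- Substituting the forced lifts of the generators into the condition on `acb` leaves exactly
`obstruction f = 0`. -/
theorem exists_splitting_of_obstruction_eq_zero (hf : IsTwoCocycle e f) (hk : (2 : k) ≠ 0)
    (he : ∀ g, e g = 1) (hd : obstruction f = 0) :
    ∃ φ : G23 → k, ∀ g h, φ (g * h) = φ g + e g * φ h + f g h := by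
  obtain ⟨φ, -, hφ⟩ := exists_splitting hf
    (fun x => -(f 1 1 + f (gen x) (gen x)) / 2)
    (fun x => lift_involution hf hk (gen_mul_self x) (.inl (he _)))
    (by
      simp only [he]
      rw [obstruction] at hd
      field_simp
      linear_combination 2 * hd)
  exact ⟨φ, hφ⟩

theorem obstruction_eq_zero_of_splitting (φ : G23 → k)
    (hφ : ∀ g h, φ (g * h) = φ g + φ h + f g h) : obstruction f = 0 := by
  have hf (g h) : f g h = φ (g * h) - φ g - φ h := by linear_combination -hφ g h
  simp only [obstruction, hf, acb_mul_self, gen_mul_self, mul_one]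
  ring

/-- The character of `G₃²` attached to a choice of signs, with values in a field. -/
def signChar (k : Type*) [Field k] (ε : G23Gen → ℤˣ) : G23 →* k :=
  ((Int.castRingHom k : ℤ →* k).comp (Units.coeHom ℤ)).comp (signHom ε)

theorem signChar_gen (ε : G23Gen → ℤˣ) (x : G23Gen) :
    signChar k ε (gen x) = ((ε x : ℤ) : k) := by
  simp [signChar, signHom]

theorem signChar_mul_self (ε : G23Gen → ℤˣ) (g : G23) :
    signChar k ε g * signChar k ε g = 1 := by
  rcases Int.units_eq_one_or (signHom ε g) with h | h <;> simp [signChar, h]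

/-- A 2-cocycle with trivial action and nonzero obstruction: `(g, h) ↦ ω(v g, s g • v h)`, where
`g ↦ (v g, s g)` maps `G₃²` to the group of translations and point reflections of a plane with
area form `ω`. -/
theorem exists_obstruction_ne_zero (hk : (2 : k) ≠ 0) :
    ∃ f : G23 → G23 → k, IsTwoCocycle 1 f ∧ obstruction f ≠ 0 := by
  let s := signChar k (fun _ => -1)
  have hs (x) : s (gen x) = -1 := by simp [s, signChar_gen]
  have h0 : IsTwoCocycle s (fun _ _ => 0) := fun g h l => by simp
  have hv (m : G23Gen → k) : ∃ φ : G23 → k, (∀ x, φ (gen x) = m x) ∧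
      ∀ g h, φ (g * h) = φ g + s g * φ h := by
    -- `s` is `-1` on the generators and on `acb`, so all conditions are vacuous and crossed
    -- homomorphisms take arbitrary values on the generators.
    simpa using exists_splitting h0 m (by simp [hs]) (by simp [hs])
  obtain ⟨p, hp, hp'⟩ := hv (fun | .c => 1 | _ => 0)
  obtain ⟨q, hq, hq'⟩ := hv (fun | .b => 1 | _ => 0)
  refine ⟨fun g h => s g * (p g * q h - q g * p h), fun g h l => ?_, ?_⟩
  · have := signChar_mul_self (k := k) (fun _ => -1) g
    change s g * s g = 1 at this
    simp only [MonoidHom.one_apply, map_mul, hp', hq']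
    linear_combination (s h * q h * p l - s h * p h * q l) * this
  · have h1 (r : G23 → k) (hr : ∀ g h, r (g * h) = r g + s g * r h) : r 1 = 0 := by
      have := hr 1 1
      simp only [mul_one, map_one, one_mul] at this
      linear_combination -this
    -- Only `f (ac) b = -1` survives, so the obstruction is `-2`.
    simp only [obstruction, map_mul, hs, hp', hq', hp, hq, map_one]
    rw [h1 p hp', h1 q hq']
    ring_nf
    simpa using hk

end

end G23

/-! ### Hochschild cochains in low degrees -/

namespace Hochschild

section

variable {k A M : Type*} [CommRing k] [Ring A] [Algebra k A] [AddCommGroup M] [Module k M]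
  [Module A M] [IsScalarTower k A M] [Module Aᵐᵒᵖ M] [IsScalarTower k Aᵐᵒᵖ M]

theorem differential_one_apply (P : Cochain k A M 1) (x y : A) :
    differential k A M 1 P ![x, y] =
      x • P ![y] - P ![x * y] + MulOpposite.op y • P ![x] := by
  have h1 : Fin.contractNth (0 : Fin 2) (· * ·) ![x, y] = ![x * y] := by
    ext i; fin_cases i; rfl
  have h2 : Fin.tail ![x, y] = ![y] := by ext i; fin_cases i; rfl
  have h3 : Fin.init ![x, y] = ![x] := by ext i; fin_cases i; rfl
  simp [differential, leftFace, rightFace, innerFace, h1, h2, h3, sub_eq_add_neg]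

theorem differential_two_apply (F : Cochain k A M 2) (x y z : A) :
    differential k A M 2 F ![x, y, z] =
      x • F ![y, z] - F ![x * y, z] + F ![x, y * z] - MulOpposite.op z • F ![x, y] := by
  have h0 : Fin.contractNth (0 : Fin 3) (· * ·) ![x, y, z] = ![x * y, z] := by
    ext i; fin_cases i <;> rfl
  have h1 : Fin.contractNth (1 : Fin 3) (· * ·) ![x, y, z] = ![x, y * z] := by
    ext i; fin_cases i <;> rfl
  have h2 : Fin.tail ![x, y, z] = ![y, z] := by ext i; fin_cases i <;> rfl
  have h3 : Fin.init ![x, y, z] = ![x, y] := by ext i; fin_cases i <;> rfl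
  have h4 : Fin.last 2 = (2 : Fin 3) := rfl
  simp only [differential, leftFace, rightFace, innerFace, Fin.sum_univ_two, LinearMap.coe_mk,
    AddHom.coe_mk, add_apply, smul_apply, MultilinearMap.coe_mk,
    Fin.castSucc_zero, Fin.castSucc_one, h0, h1, h2, h3, h4]
  simp
  abel

end

section

variable {k G M : Type*} [CommRing k] [Group G] [AddCommGroup M] [Module k M]

/-- Cochains of a group algebra are determined by their values on group elements. -/
theorem Cochain.ext_of {n : ℕ} {F F' : Cochain k (MonoidAlgebra k G) M n}
    (h : ∀ v : Fin n → G, F (fun i => MonoidAlgebra.of k G (v i)) =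
      F' (fun i => MonoidAlgebra.of k G (v i))) : F = F' :=
  Module.Basis.ext_multilinear (fun _ => MonoidAlgebra.basis G k) fun v => by
    simpa using h v

theorem exists_cochain_one (φ : G → M) :
    ∃ P : Cochain k (MonoidAlgebra k G) M 1, ∀ g, P ![MonoidAlgebra.of k G g] = φ g := by
  let b := MonoidAlgebra.basis G k
  refine ⟨MultilinearMap.ofSubsingleton k _ M 0 (b.constr k φ), fun g => ?_⟩
  simpa [b] using b.constr_basis k φ g

theorem exists_cochain_two (f : G → G → M) :
    ∃ F : Cochain k (MonoidAlgebra k G) M 2,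
      ∀ g h, F ![MonoidAlgebra.of k G g, MonoidAlgebra.of k G h] = f g h := by
  let b := MonoidAlgebra.basis G k
  choose P hP using fun g => exists_cochain_one (k := k) (f g)
  let L : MonoidAlgebra k G →ₗ[k] Cochain k (MonoidAlgebra k G) M 1 := b.constr k P
  refine ⟨LinearMap.uncurryLeft (M := fun _ => MonoidAlgebra k G) L, fun g h => ?_⟩
  have hL : L (MonoidAlgebra.of k G g) = P g := by
    simpa [b] using b.constr_basis k P g
  have ht : Fin.tail ![MonoidAlgebra.of k G g, MonoidAlgebra.of k G h] =
      ![MonoidAlgebra.of k G h] := by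
    ext1 i; fin_cases i; rfl
  rw [LinearMap.uncurryLeft_apply, ht, Matrix.cons_val_zero, hL, hP]

end

end Hochschild

/-! ### Comparison with twisted group cocycles -/

/-- The underlying vector space of a one-dimensional bimodule. -/
def CharBimodule.toField {k A : Type*} [Field k] [Ring A] [Algebra k A] (χ₁ χ₂ : A →ₐ[k] k) :
    CharBimodule χ₁ χ₂ ≃ₗ[k] k := LinearEquiv.refl k k

namespace G23

open Hochschild CharBimodule

variable {k : Type*} [Field k]

/-- A group element as an element of the group algebra. -/
noncomputable abbrev elt (k : Type*) [Field k] (g : G23) : MonoidAlgebra k G23 :=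
  MonoidAlgebra.of k G23 g

theorem character_elt (ε : G23Gen → ℤˣ) (g : G23) : character k ε (elt k g) = signChar k ε g := by
  simp [character, signChar]

/-- The one-sided function on pairs of group elements attached to a Hochschild 2-cochain. -/
noncomputable def twist (k : Type*) [Field k] (ε₁ ε₂ : G23Gen → ℤˣ) :
    Cochain k (MonoidAlgebra k G23) (W k ε₁ ε₂) 2 →ₗ[k] G23 → G23 → k where
  -- Signs are their own inverses, so this factor undoes the right action.
  toFun F g h := signChar k ε₂ (g * h) * toField _ _ (F ![elt k g, elt k h])
  map_add' F F' := by ext g h; simp [mul_add]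
  map_smul' c F := by ext g h; simp [mul_left_comm]

variable {ε₁ ε₂ : G23Gen → ℤˣ}

theorem twist_apply (F : Cochain k (MonoidAlgebra k G23) (W k ε₁ ε₂) 2) (g h : G23) :
    twist k ε₁ ε₂ F g h =
      signChar k ε₂ g * signChar k ε₂ h * toField _ _ (F ![elt k g, elt k h]) := by
  simp [twist]

theorem twist_surjective : Function.Surjective (twist k ε₁ ε₂) := by
  intro f
  obtain ⟨F, hF⟩ := exists_cochain_two (k := k)
    (fun g h : G23 => (toField (character k ε₁) (character k ε₂)).symm
      (signChar k ε₂ (g * h) * f g h))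
  refine ⟨F, ?_⟩
  ext g h
  simp only [twist_apply, hF, LinearEquiv.apply_symm_apply, map_mul]
  linear_combination (f g h * signChar k ε₂ h ^ 2) * signChar_mul_self (k := k) ε₂ g +
    f g h * signChar_mul_self (k := k) ε₂ h

theorem toField_elt_smul (g : G23) (w : W k ε₁ ε₂) :
    toField _ _ (elt k g • w) = signChar k ε₁ g * toField _ _ w := by
  rw [CharBimodule.smul_def, character_elt, map_smul, smul_eq_mul]

theorem toField_op_elt_smul (g : G23) (w : W k ε₁ ε₂) :
    toField _ _ (MulOpposite.op (elt k g) • w) = signChar k ε₂ g * toField _ _ w := by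
  rw [CharBimodule.op_smul_def, character_elt, map_smul, smul_eq_mul]

/-- The twisted cocycle expression at `g, h, l` is the Hochschild differential there times the unit
`ε₂(ghl)`; group elements suffice by multilinearity. -/
theorem isTwoCocycle_twist {F : Cochain k (MonoidAlgebra k G23) (W k ε₁ ε₂) 2} :
    IsTwoCocycle (signChar k ε₁ * signChar k ε₂) (twist k ε₁ ε₂ F) ↔
      F ∈ cocycles k (MonoidAlgebra k G23) (W k ε₁ ε₂) 2 := by
  have key (g h l : G23) : (signChar k ε₁ * signChar k ε₂) g * twist k ε₁ ε₂ F h l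
      - twist k ε₁ ε₂ F (g * h) l + twist k ε₁ ε₂ F g (h * l) - twist k ε₁ ε₂ F g h =
      signChar k ε₂ (g * h * l) * toField _ _
        (differential k _ (W k ε₁ ε₂) 2 F ![elt k g, elt k h, elt k l]) := by
    rw [differential_two_apply]
    simp only [map_sub, map_add, toField_elt_smul, toField_op_elt_smul, twist_apply,
      MonoidHom.mul_apply, map_mul]
    linear_combination (signChar k ε₂ g * signChar k ε₂ h *
      toField _ _ (F ![elt k g, elt k h])) * signChar_mul_self (k := k) ε₂ l
  constructor
  · intro hF
    rw [cocycles, LinearMap.mem_ker]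
    refine Cochain.ext_of fun v => ?_
    have hv : (fun i => MonoidAlgebra.of k G23 (v i)) =
        ![elt k (v 0), elt k (v 1), elt k (v 2)] := by
      ext1 i; fin_cases i <;> rfl
    have h := hF (v 0) (v 1) (v 2)
    rw [key] at h
    have hne : signChar k ε₂ (v 0 * v 1 * v 2) ≠ 0 :=
      left_ne_zero_of_mul_eq_one (signChar_mul_self ε₂ _)
    rw [hv]
    exact (LinearEquiv.map_eq_zero_iff _).mp ((mul_eq_zero.mp h).resolve_left hne)
  · intro hF g h l
    rw [cocycles, LinearMap.mem_ker] at hF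
    rw [key, hF]
    simp

theorem mem_coboundaries_iff {F : Cochain k (MonoidAlgebra k G23) (W k ε₁ ε₂) 2} :
    F ∈ coboundaries k (MonoidAlgebra k G23) (W k ε₁ ε₂) 2 ↔
      ∃ φ : G23 → k, ∀ g h, φ (g * h) =
        φ g + (signChar k ε₁ * signChar k ε₂) g * φ h + twist k ε₁ ε₂ F g h := by
  constructor
  · rintro ⟨P, rfl⟩
    -- The sign appears because a splitting `φ` exhibits the cocycle as minus the coboundary of `φ`.
    refine ⟨fun g => -(signChar k ε₂ g * toField _ _ (P ![elt k g])), fun g h => ?_⟩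
    rw [twist_apply, differential_one_apply]
    simp only [map_sub, map_add, toField_elt_smul, toField_op_elt_smul, MonoidHom.mul_apply,
      map_mul]
    linear_combination (-signChar k ε₂ g * toField _ _ (P ![elt k g])) *
      signChar_mul_self (k := k) ε₂ h
  · rintro ⟨φ, hφ⟩
    obtain ⟨P, hP⟩ := exists_cochain_one (k := k)
      (fun g : G23 => (toField (character k ε₁) (character k ε₂)).symm
        (-(signChar k ε₂ g * φ g)))
    refine ⟨P, Cochain.ext_of fun v => ?_⟩
    have hv : (fun i => MonoidAlgebra.of k G23 (v i)) = ![elt k (v 0), elt k (v 1)] := by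
      ext1 i; fin_cases i <;> rfl
    rw [hv, differential_one_apply]
    apply (toField _ _).injective
    have h := hφ (v 0) (v 1)
    have hmul : elt k (v 0) * elt k (v 1) = elt k (v 0 * v 1) := (map_mul _ _ _).symm
    rw [twist_apply] at h
    simp only [map_sub, map_add, toField_elt_smul, toField_op_elt_smul, hmul, hP,
      LinearEquiv.apply_symm_apply, map_mul (signChar k ε₂), MonoidHom.mul_apply] at h ⊢
    have h0 := signChar_mul_self (k := k) ε₂ (v 0)
    have h1 := signChar_mul_self (k := k) ε₂ (v 1)
    generalize toField _ _ (F ![elt k (v 0), elt k (v 1)]) = y at *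
    linear_combination signChar k ε₂ (v 0) * signChar k ε₂ (v 1) * h + y * h0 +
      y * signChar k ε₂ (v 0) ^ 2 * h1 + signChar k ε₁ (v 0) * signChar k ε₂ (v 1) * φ (v 1) * h0

/-! ### The second cohomology -/

theorem subsingleton_HH2
    (h : ∀ f : G23 → G23 → k, IsTwoCocycle (signChar k ε₁ * signChar k ε₂) f →
      ∃ φ : G23 → k, ∀ g h, φ (g * h) =
        φ g + (signChar k ε₁ * signChar k ε₂) g * φ h + f g h) :
    Subsingleton (HH2 k ε₁ ε₂) := by
  rw [Submodule.Quotient.subsingleton_iff, Submodule.submoduleOf_eq_top]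
  exact fun F hF => mem_coboundaries_iff.mpr (h _ (isTwoCocycle_twist.mpr hF))

theorem signChar_mul_gen (x : G23Gen) :
    (signChar k ε₁ * signChar k ε₂) (gen x) = ((ε₁ x * ε₂ x : ℤˣ) : ℤ) := by
  simp [signChar_gen]

theorem signChar_mul_gen_eq (x : G23Gen) :
    (signChar k ε₁ * signChar k ε₂) (gen x) = 1 ∨
      (signChar k ε₁ * signChar k ε₂) (gen x) = -1 := by
  rw [signChar_mul_gen]
  rcases Int.units_eq_one_or (ε₁ x * ε₂ x) with h | h <;> simp [h]

theorem signChar_mul_acb : (signChar k ε₁ * signChar k ε₂) acb =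
    ((ε₁ .a * ε₂ .a * (ε₁ .c * ε₂ .c) * (ε₁ .b * ε₂ .b) : ℤˣ) : ℤ) := by
  rw [map_mul, map_mul, signChar_mul_gen, signChar_mul_gen, signChar_mul_gen]
  push_cast
  ring

theorem subsingleton_HH2_of_acb (hk : (2 : k) ≠ 0)
    (h : ε₁ .a * ε₂ .a * (ε₁ .c * ε₂ .c) * (ε₁ .b * ε₂ .b) = -1) :
    Subsingleton (HH2 k ε₁ ε₂) :=
  subsingleton_HH2 fun _ hf => exists_splitting_of_acb_eq_neg_one hf hk signChar_mul_gen_eq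
    (by rw [signChar_mul_acb, h]; simp)

theorem subsingleton_HH2_of_b (hk : (2 : k) ≠ 0)
    (h : ε₁ .a * ε₂ .a * (ε₁ .c * ε₂ .c) * (ε₁ .b * ε₂ .b) = 1) (hb : ε₁ .b * ε₂ .b = -1) :
    Subsingleton (HH2 k ε₁ ε₂) :=
  subsingleton_HH2 fun _ hf => exists_splitting_of_b_eq_neg_one hf hk signChar_mul_gen_eq
    (by rw [signChar_mul_acb, h]; simp) (by rw [signChar_mul_gen, hb]; simp)

/-- The obstruction as a linear functional. -/
def obstructionₗ (k : Type*) [Field k] : (G23 → G23 → k) →ₗ[k] k where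
  toFun := obstruction
  map_add' f f' := by simp only [obstruction, Pi.add_apply]; ring
  map_smul' c f := by
    simp only [obstruction, Pi.smul_apply, smul_eq_mul, RingHom.id_apply]; ring

/-- Equal characters give `e = 1`, since signs square to 1. The obstruction then induces an
isomorphism of the cohomology with `k`. -/
theorem finrank_HH2_self (hk : (2 : k) ≠ 0) (ε : G23Gen → ℤˣ) :
    Module.finrank k (HH2 k ε ε) = 1 := by
  have he : signChar k ε * signChar k ε = 1 := MonoidHom.ext (signChar_mul_self ε)
  let T : cocycles k (MonoidAlgebra k G23) (W k ε ε) 2 →ₗ[k] k :=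
    obstructionₗ k ∘ₗ twist k ε ε ∘ₗ Submodule.subtype _
  have hT (F) : T F = obstruction (twist k ε ε F) := rfl
  have hker : LinearMap.ker T =
      (coboundaries k (MonoidAlgebra k G23) (W k ε ε) 2).submoduleOf (cocycles k _ _ 2) := by
    ext F
    rw [LinearMap.mem_ker, hT, Submodule.submoduleOf, Submodule.mem_comap, Submodule.subtype_apply,
       mem_coboundaries_iff]
    constructor
    · exact exists_splitting_of_obstruction_eq_zero (isTwoCocycle_twist.mpr F.2) hk
        (by simp [he])
    · rintro ⟨φ, hφ⟩
      exact obstruction_eq_zero_of_splitting φ (by simpa [he] using hφ)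
  have hsurj : Function.Surjective T := by
    apply LinearMap.surjective
    obtain ⟨f, hf, hne⟩ := exists_obstruction_ne_zero hk
    obtain ⟨F, rfl⟩ := twist_surjective (ε₁ := ε) (ε₂ := ε) f
    intro h0
    exact hne ((hT ⟨F, isTwoCocycle_twist.mp (he ▸ hf)⟩).symm.trans (by rw [h0]; rfl))
  change Module.finrank k (_ ⧸ Submodule.submoduleOf _ _) = 1
  rw [← hker, (T.quotKerEquivOfSurjective hsurj).finrank_eq, Module.finrank_self]

end G23

theorem mainTheorem3 (k : Type*) [Field k] (hk : (2 : k) ≠ 0) :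
    -- `W₁` and `W₅`
    Module.finrank k (G23.HH2 k (G23.signs 1 1 1) (G23.signs 1 1 1)) = 1 ∧
    Module.finrank k (G23.HH2 k (G23.signs 1 1 (-1)) (G23.signs 1 1 (-1))) = 1 ∧
    -- `W₂`, `W₃`, `W₄`
    Subsingleton (G23.HH2 k (G23.signs 1 1 1) (G23.signs (-1) (-1) (-1))) ∧
    Subsingleton (G23.HH2 k (G23.signs 1 1 1) (G23.signs 1 1 (-1))) ∧
    Subsingleton (G23.HH2 k (G23.signs 1 1 1) (G23.signs 1 (-1) (-1))) ∧
    -- `W₆`, `W₇`, `W₈`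
    Subsingleton (G23.HH2 k (G23.signs 1 1 (-1)) (G23.signs (-1) (-1) 1)) ∧
    Subsingleton (G23.HH2 k (G23.signs 1 1 (-1)) (G23.signs 1 (-1) (-1))) ∧
    Subsingleton (G23.HH2 k (G23.signs 1 1 (-1)) (G23.signs 1 (-1) 1)) := by
  -- The signs of `e` on `a, b, c` are `---` for `W₂`, `W₆`, `++-` for `W₃` and `+-+` for `W₇`, all
  -- with `e acb = -1`; for `W₄`, `W₈` they are `+--`, with `e acb = 1` and `e b = -1`.
  refine ⟨G23.finrank_HH2_self hk _, G23.finrank_HH2_self hk _,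
    G23.subsingleton_HH2_of_acb hk ?_, G23.subsingleton_HH2_of_acb hk ?_,
    G23.subsingleton_HH2_of_b hk ?_ ?_, G23.subsingleton_HH2_of_acb hk ?_,
    G23.subsingleton_HH2_of_acb hk ?_, G23.subsingleton_HH2_of_b hk ?_ ?_⟩ <;>
  simp [G23.signs]
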